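/- Let $(\Omega,\mathcal F,\mathbb P)$ be a non-atomic probability space, and let $L^0$ be the space of real random variables modulo a.s. equality; write $X\sim Y$ if $X$ and $Y$ have the same distribution. Let $\mathcal X\neq\{0\}$ be a rearrangement-invariant space over $(\Omega,\mathcal F,\mathbb P)$, i.e. a linear subspace of $L^0$ with a complete norm $\|\cdot\|$ such that for every $X\in\mathcal X$: (1) if $Y\in L^0$ and $|Y|\le|X|$ a.s., then $Y\in\mathcal X$ and $\|Y\|\le\|X\|$; (2) if $Z\in L^0$ and $Z\sim X$, then $Z\in\mathcal X$ and $\|Z\|=\|X\|$. Let $\mathcal X_a=\{X\in\mathcal X:\ \lim_{\mathbb P(A)\to0}\|X\mathbf 1_A\|=0\}$ be the order continuous part of $\mathcal X$, and for $X\in\mathcal X$ let $\mathcal{CL}(X)=\mathrm{co}\{Y: Y\sim X\}$ be the convex hull of the set of random variables distributed as $X$. Assume that $\mathcal X\neq L^\infty$ and that $\mathcal X$ has the AOCEA property: for every $X\in\mathcal X$ with $X\ge0$ a.s., $$\inf\{\|Y-V\|:\ Y\in\mathcal{CL}(X),\ V\in\mathcal X_a\}=0 .$$ Then every $X\in\mathcal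 X$ is integrable, $\mathbf 1\in\mathcal X$, and with $$\mathcal S=\mathrm{span}\{X-Y:\ X,Y\in\mathcal X,\ X\sim Y\},\qquad \mathcal M=\{X\in\mathcal X:\ \mathbb E[X]=0\},$$ one has $\overline{\mathcal S}=\mathcal M$, where the closure is taken in the norm of $\mathcal X$. Hence every bounded linear functional $\rho:\mathcal X\to\mathbb R$ that is law-invariant (that is, $\rho(X)=\rho(Y)$ whenever $X,Y\in\mathcal X$ and $X\sim Y$) satisfies $\rho(X)=\rho(\mathbf 1)\,\mathbb E[X]$ for all $X\in\mathcal X$. -/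

import Mathlib

open MeasureTheory ProbabilityTheory Filter Topology

noncomputable section

/-- A measure is non-atomic if every measurable set of positive measure has a measurable subset of
strictly smaller positive measure. (This is a condition on measurable sets; it is stronger than
Mathlib's `NoAtoms`, which only says that singletons are null.) -/
def NonAtomic {Ω : Type*} [MeasurableSpace Ω] (P : Measure Ω) : Prop :=
  ∀ A : Set Ω, MeasurableSet A → 0 < P A → ∃ B ⊆ A, MeasurableSet B ∧ 0 < P B ∧ P B < P A

/-- A (nonzero) rearrangement-invariant space over `(Ω, P)`: a nonzero Banach space of classes of
random variables modulo almost sure equality, solid and law-invariant together with its norm. -/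
structure RISpace {Ω : Type*} [MeasurableSpace Ω] (P : Measure Ω) where
  /-- the underlying linear space of random variables -/
  carrier : Submodule ℝ (Ω →ₘ[P] ℝ)
  /-- the norm -/
  nrm : carrier → ℝ
  nrm_nonneg : ∀ f, 0 ≤ nrm f
  nrm_smul : ∀ (c : ℝ) (f), nrm (c • f) = |c| * nrm f
  nrm_add_le : ∀ f g, nrm (f + g) ≤ nrm f + nrm g
  eq_zero_of_nrm : ∀ f, nrm f = 0 → f = 0
  /-- norm-completeness -/
  complete : ∀ u : ℕ → carrier,
    (∀ ε > 0, ∃ N, ∀ m ≥ N, ∀ n ≥ N, nrm (u m - u n) < ε) →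
      ∃ f : carrier, Tendsto (fun n => nrm (u n - f)) atTop (𝓝 0)
  solid : ∀ (f : carrier) (g : Ω →ₘ[P] ℝ), (∀ᵐ ω ∂P, |g ω| ≤ |(f : Ω →ₘ[P] ℝ) ω|) →
    ∃ hg : g ∈ carrier, nrm ⟨g, hg⟩ ≤ nrm f
  lawInvariant : ∀ (f : carrier) (g : Ω →ₘ[P] ℝ), IdentDistrib g (f : Ω →ₘ[P] ℝ) P P →
    ∃ hg : g ∈ carrier, nrm ⟨g, hg⟩ = nrm f
  ne_bot : carrier ≠ ⊥

namespace RISpace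

variable {Ω : Type*} [MeasurableSpace Ω] {P : Measure Ω}

/-- The elements of `X`, as a type of its own carrying the norm of `X`. -/
def Elem (X : RISpace P) : Type _ := X.carrier

instance : CoeSort (RISpace P) (Type _) := ⟨Elem⟩

variable {X : RISpace P}

/-- The random variable (modulo a.s. equality) underlying an element of `X`. -/
def Elem.rv (f : X) : Ω →ₘ[P] ℝ := Subtype.val (p := (· ∈ X.carrier)) f

instance : AddCommGroup X := inferInstanceAs (AddCommGroup X.carrier)

instance : Module ℝ X := inferInstanceAs (Module ℝ X.carrier)

instance : Norm X := ⟨X.nrm⟩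

theorem normCore (X : RISpace P) : NormedSpace.Core ℝ X where
  norm_nonneg := X.nrm_nonneg
  norm_smul := X.nrm_smul
  norm_triangle := X.nrm_add_le
  norm_eq_zero_iff f := by
    refine ⟨X.eq_zero_of_nrm f, ?_⟩
    rintro rfl
    have h := X.nrm_smul 0 0
    rw [abs_zero, zero_mul, zero_smul] at h
    exact h

instance : NormedAddCommGroup X := NormedAddCommGroup.ofCore X.normCore

instance : NormedSpace ℝ X := NormedSpace.ofCore X.normCore

/-- `X` is a Banach space. -/
instance : CompleteSpace X := by
  refine Metric.complete_of_cauchySeq_tendsto fun u hu => ?_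
  obtain ⟨f, hf⟩ := X.complete u (fun ε hε => by
    obtain ⟨N, hN⟩ := Metric.cauchySeq_iff.1 hu ε hε
    refine ⟨N, fun m hm n hn => ?_⟩
    have h := hN m hm n hn
    rw [dist_eq_norm] at h
    exact h)
  exact ⟨f, tendsto_iff_norm_sub_tendsto_zero.2 hf⟩

/-- `X ∼ Y`: the two random variables have the same distribution. -/
def SameLaw (f g : X) : Prop := IdentDistrib f.rv g.rv P P

/-- The random variable `X 1_A`, which again belongs to the space. -/
def restrict (f : X) (A : Set Ω) (hA : MeasurableSet A) : X :=
  Subtype.mk (p := (· ∈ X.carrier))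
    (AEEqFun.mk (A.indicator f.rv) (f.rv.aestronglyMeasurable.indicator hA))
    (X.solid f _ (by
      filter_upwards [AEEqFun.coeFn_mk (A.indicator f.rv)
        (f.rv.aestronglyMeasurable.indicator hA)] with ω hω
      rw [hω]
      by_cases h : ω ∈ A
      · rw [Set.indicator_of_mem h]; exact le_rfl
      · rw [Set.indicator_of_notMem h, abs_zero]; exact abs_nonneg _)).1

/-- The order continuous part: all `X` in the space with `‖X 1_A‖ → 0` as `P(A) → 0`. -/
def orderContPart (X : RISpace P) : Set X :=
  {f | ∀ ε > 0, ∃ δ > 0, ∀ (A : Set Ω) (hA : MeasurableSet A),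
    P.real A < δ → ‖restrict f A hA‖ < ε}

/-- The convex hull of all random variables with the same distribution as `f`. -/
def lawHull (f : X) : Set X := convexHull ℝ {g | SameLaw g f}

/-- The AOCEA property: for every `X ≥ 0` in the space, the (norm) distance between the sets
`lawHull X` and `orderContPart` is `0`. -/
def AOCEA (X : RISpace P) : Prop :=
  ∀ f : X, (∀ᵐ ω ∂P, 0 ≤ f.rv ω) →
    ∀ ε > 0, ∃ g ∈ lawHull f, ∃ v ∈ X.orderContPart, ‖g - v‖ < ε

/-- The linear span of the differences of identically distributed elements. -/
def lawSpan (X : RISpace P) : Submodule ℝ X :=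
  Submodule.span ℝ {h | ∃ f g : X, SameLaw f g ∧ h = f - g}

/-- The elements with expectation zero. -/
def meanZero (X : RISpace P) : Set X := {f | ∫ ω, f.rv ω ∂P = 0}

/-- A functional is law-invariant if it takes equal values at identically distributed elements. -/
def IsLawInvariant (ρ : X → ℝ) : Prop := ∀ f g : X, SameLaw f g → ρ f = ρ g

end RISpace

end

/-! ### Non-atomic probability spaces -/

section NonAtomic

variable {Ω : Type*} [MeasurableSpace Ω] {P : Measure Ω} [IsProbabilityMeasure P]

/-! Let `K` be the set of `f` with `f - E[f] • 1` in the closure of `lawSpan`. The point is that `K`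
is everything.

The core is finite averaging. If `f = a(L)` with `L` uniform on `Fin N`, the cyclic shifts `a(L +
s)` all have the law of `f`, and their average is the constant `E[f]`. Hence `f - E[f] • 1` lies in
`lawSpan`, and the triangle inequality gives `|E[f]| * ‖1‖ ≤ ‖f‖` (`uniform_factor_average`).
Non-atomicity makes this available for every simple variable after it is set to zero on a small
event. Through monotone approximation of `|f|` the inequality makes every element integrable and the
expectation norm-continuous, so `K` is a closed subspace.

`K` then grows by approximation: to simple variables, because small events have small norm when the
space is not `L^∞` (`norm_indicator_small`); to bounded ones uniformly; to the order continuous part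
by truncation. AOCEA gives the rest: replacing `f ≥ 0` by an element of its law hull changes it only
by an element of `lawSpan`, and some such element is close to the order continuous part
(`mem_of_aocea`).

Conversely, the expectation is continuous and kills `lawSpan`; a law-invariant `ρ` kills its closure
too, hence every `f - E[f] • 1`. -/

theorem NonAtomic.exists_measureReal_lt (hP : NonAtomic P) {A : Set Ω} (hA : MeasurableSet A)
    (h0 : 0 < P.real A) : ∃ B ⊆ A, MeasurableSet B ∧ 0 < P.real B ∧ P.real B < P.real A := by
  obtain ⟨B, hBA, hB, hB0, hBlt⟩ := hP A hA (by
    rw [measureReal_def, ENNReal.toReal_pos_iff] at h0; exact h0.1)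
  refine ⟨B, hBA, hB, ENNReal.toReal_pos hB0.ne' (measure_ne_top _ _), ?_⟩
  exact (ENNReal.toReal_lt_toReal (measure_ne_top _ _) (measure_ne_top _ _)).2 hBlt

/-- Split off a proper piece and keep the smaller half; each split at least halves the probability.
-/
theorem NonAtomic.exists_measureReal_le_div_two_pow (hP : NonAtomic P) {A : Set Ω}
    (hA : MeasurableSet A) (h0 : 0 < P.real A) (n : ℕ) :
    ∃ B ⊆ A, MeasurableSet B ∧ 0 < P.real B ∧ P.real B ≤ P.real A / 2 ^ n := by
  induction n with
  | zero => exact ⟨A, subset_rfl, hA, h0, by simp⟩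
  | succ n ih =>
    obtain ⟨B, hBA, hB, hB0, hBle⟩ := ih
    obtain ⟨C, hCB, hC, hC0, hClt⟩ := hP.exists_measureReal_lt hB hB0
    have hdiff : P.real (B \ C) = P.real B - P.real C := measureReal_sdiff hCB hC
    have hhalf : P.real A / 2 ^ (n + 1) = (P.real A / 2 ^ n) / 2 := by rw [pow_succ]; ring
    rcases le_total (P.real C) (P.real (B \ C)) with h | h
    · exact ⟨C, hCB.trans hBA, hC, hC0, by rw [hhalf]; linarith⟩
    · exact ⟨B \ C, Set.sdiff_subset.trans hBA, hB.diff hC, by linarith, by rw [hhalf]; linarith⟩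

theorem NonAtomic.exists_measureReal_le (hP : NonAtomic P) {A : Set Ω} (hA : MeasurableSet A)
    (h0 : 0 < P.real A) {ε : ℝ} (hε : 0 < ε) :
    ∃ B ⊆ A, MeasurableSet B ∧ 0 < P.real B ∧ P.real B ≤ ε := by
  obtain ⟨n, hn⟩ := exists_pow_lt_of_lt_one hε (by norm_num : (1 / 2 : ℝ) < 1)
  obtain ⟨B, hBA, hB, hB0, hBle⟩ := hP.exists_measureReal_le_div_two_pow hA h0 n
  refine ⟨B, hBA, hB, hB0, hBle.trans (le_trans ?_ hn.le)⟩
  rw [div_eq_mul_inv, one_div, inv_pow]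
  exact mul_le_of_le_one_left (by positivity) measureReal_le_one

/-- Sierpiński's theorem: a non-atomic measure takes all intermediate values. -/
theorem NonAtomic.exists_measureReal_eq (hP : NonAtomic P) {A : Set Ω} (hA : MeasurableSet A)
    {t : ℝ} (ht0 : 0 ≤ t) (htA : t ≤ P.real A) :
    ∃ B ⊆ A, MeasurableSet B ∧ P.real B = t := by
  let T := {B : Set Ω // MeasurableSet B ∧ B ⊆ A ∧ P.real B ≤ t}
  -- Greedy choice: the next set realizes at least half of the largest gain still possible below
  -- `t`.
  have step : ∀ B : T, ∃ C : T, B.1 ⊆ C.1 ∧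
      ∀ D : T, B.1 ⊆ D.1 → P.real D.1 - P.real B.1 ≤ 2 * (P.real C.1 - P.real B.1) := by
    intro B
    let V : Set ℝ := (fun D : T => P.real D.1) '' {D | B.1 ⊆ D.1}
    have hVne : V.Nonempty := ⟨_, B, Set.Subset.refl _, rfl⟩
    have hVb : BddAbove V := ⟨t, by rintro _ ⟨D, -, rfl⟩; exact D.2.2.2⟩
    have hBV : P.real B.1 ≤ sSup V := le_csSup hVb ⟨B, Set.Subset.refl _, rfl⟩
    rcases hBV.eq_or_lt with h | h
    · refine ⟨B, subset_rfl, fun D hD => ?_⟩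
      have : P.real D.1 ≤ sSup V := le_csSup hVb ⟨D, hD, rfl⟩
      linarith
    · obtain ⟨_, ⟨C, hC, rfl⟩, hlt⟩ :=
        exists_lt_of_lt_csSup hVne (show (P.real B.1 + sSup V) / 2 < sSup V by linarith)
      refine ⟨C, hC, fun D hD => ?_⟩
      have : P.real D.1 ≤ sSup V := le_csSup hVb ⟨D, hD, rfl⟩
      simp only at hlt
      linarith
  choose next hnext hbig using step
  let u : ℕ → T := fun n =>
    Nat.rec ⟨∅, MeasurableSet.empty, Set.empty_subset _, by simpa using ht0⟩ (fun _ B => next B) n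
  have hu : ∀ n, u (n + 1) = next (u n) := fun n => rfl
  have hmono : Monotone fun n => (u n).1 :=
    monotone_nat_of_le_succ fun n => by rw [hu]; exact hnext _
  set B : Set Ω := ⋃ n, (u n).1
  have hB : MeasurableSet B := MeasurableSet.iUnion fun n => (u n).2.1
  have hBA : B ⊆ A := Set.iUnion_subset fun n => (u n).2.2.1
  have htend : Tendsto (fun n => P.real (u n).1) atTop (𝓝 (P.real B)) :=
    (ENNReal.tendsto_toReal (measure_ne_top _ _)).comp (tendsto_measure_iUnion_atTop hmono)
  have hBt : P.real B ≤ t := le_of_tendsto' htend fun n => (u n).2.2.2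
  refine ⟨B, hBA, hB, hBt.antisymm (not_lt.1 fun hlt => ?_)⟩
  have hAB : P.real (A \ B) = P.real A - P.real B := measureReal_sdiff hBA hB
  obtain ⟨D, hDA, hD, hD0, hDle⟩ := hP.exists_measureReal_le (hA.diff hB) (by linarith)
    (sub_pos.2 hlt)
  -- If the limit fell short of `t`, the leftover piece `D` could be added at every stage, so the
  -- gains would stay bounded below although they tend to zero.
  have hle : ∀ n, P.real D ≤ 2 * (P.real (u (n + 1)).1 - P.real (u n).1) := by
    intro n
    have hsub : (u n).1 ⊆ B := Set.subset_iUnion (fun n => (u n).1) n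
    have hdisj : Disjoint (u n).1 D :=
      (Set.disjoint_sdiff_right (s := B) (t := A)).mono hsub hDA
    have hun : P.real ((u n).1 ∪ D) = P.real (u n).1 + P.real D := measureReal_union hdisj hD
    have hun_le : P.real (u n).1 ≤ P.real B := measureReal_mono hsub
    have := hbig (u n) ⟨(u n).1 ∪ D, (u n).2.1.union hD,
      Set.union_subset (u n).2.2.1 (hDA.trans Set.sdiff_subset), by linarith⟩
      Set.subset_union_left
    simp only [hun] at this
    rw [hu]
    linarith
  have hlim : Tendsto (fun n => 2 * (P.real (u (n + 1)).1 - P.real (u n).1)) atTop (𝓝 0) := by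
    have := ((htend.comp (tendsto_add_atTop_nat 1)).sub htend).const_mul 2
    simpa using this
  linarith [ge_of_tendsto' hlim hle]

theorem NonAtomic.exists_disjoint_measureReal_eq (hP : NonAtomic P) {r : ℝ} (hr : 0 ≤ r) (k : ℕ)
    {A : Set Ω} (hA : MeasurableSet A) (hAk : P.real A = k * r) :
    ∃ C : Fin k → Set Ω, (∀ j, MeasurableSet (C j)) ∧ (∀ j, C j ⊆ A) ∧
      Pairwise (Function.onFun Disjoint C) ∧ ∀ j, P.real (C j) = r := by
  induction k generalizing A with
  | zero => exact ⟨fun j => j.elim0, fun j => j.elim0, fun j => j.elim0, fun j => j.elim0,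
      fun j => j.elim0⟩
  | succ k ih =>
    push_cast at hAk
    have hkr : 0 ≤ (k : ℝ) * r := by positivity
    obtain ⟨B, hBA, hB, hBr⟩ := hP.exists_measureReal_eq hA hr (by linarith)
    have hAB : P.real (A \ B) = P.real A - P.real B := measureReal_sdiff hBA hB
    obtain ⟨C, hC, hCA, hCd, hCr⟩ := ih (hA.diff hB) (by linarith)
    have hdisj : ∀ j, Disjoint B (C j) := fun j => Set.disjoint_sdiff_right.mono_right (hCA j)
    refine ⟨Fin.cons B C, ?_, ?_, ?_, ?_⟩
    · intro j; cases j using Fin.cases <;> simp [hB, hC]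
    · intro j
      cases j using Fin.cases with
      | zero => simpa using hBA
      | succ j => simpa using (hCA j).trans Set.sdiff_subset
    · intro i j hij
      cases i using Fin.cases with
      | zero =>
        cases j using Fin.cases with
        | zero => exact absurd rfl hij
        | succ j => simpa [Function.onFun] using hdisj j
      | succ i =>
        cases j using Fin.cases with
        | zero => simpa [Function.onFun] using (hdisj i).symm
        | succ j => simpa [Function.onFun] using hCd (fun h => hij (by rw [h]))
    · intro j; cases j using Fin.cases <;> simp [hBr, hCr]

/-! ### Reduction to uniform variables with finitely many values -/

/-- `N` disjoint events of probability `1 / N` each are, up to null sets, the level sets of a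
random variable. -/
theorem exists_measurable_fin_of_disjoint {N : ℕ} [NeZero N] {C : Fin N → Set Ω}
    (hC : ∀ i, MeasurableSet (C i)) (hCd : Pairwise (Function.onFun Disjoint C))
    (hCr : ∀ i, P.real (C i) = (N : ℝ)⁻¹) :
    ∃ L : Ω → Fin N, Measurable L ∧ (∀ i, P.real (L ⁻¹' {i}) = (N : ℝ)⁻¹) ∧
      ∀ᵐ ω ∂P, ω ∈ C (L ω) := by
  classical
  have huniq : ∀ {i j ω}, ω ∈ C i → ω ∈ C j → i = j := fun {i j ω} hi hj => by
    by_contra h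
    exact Set.disjoint_left.1 (hCd h) hi hj
  -- The default value `0` is taken only off the union, which is a null set.
  let L : Ω → Fin N := fun ω => if h : ∃ i, ω ∈ C i then h.choose else 0
  have hL : ∀ i, ∀ ω ∈ C i, L ω = i := fun i ω hω => by
    have h : ∃ i, ω ∈ C i := ⟨i, hω⟩
    simp only [L, dif_pos h]
    exact huniq h.choose_spec hω
  have hU : MeasurableSet (⋃ i, C i) := MeasurableSet.iUnion hC
  have hN : (N : ℝ) ≠ 0 := NeZero.ne _
  have hU1 : P.real (⋃ i, C i) = 1 := by
    rw [measureReal_iUnion_fintype hCd hC]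
    simp [hCr, hN]
  have hU0 : P.real (⋃ i, C i)ᶜ = 0 := by rw [probReal_compl_eq_one_sub hU, hU1, sub_self]
  have hae : ∀ᵐ ω ∂P, ω ∈ ⋃ i, C i := by
    rw [ae_iff]
    exact (measureReal_eq_zero_iff (μ := P)).1 hU0
  have hpre : ∀ i, L ⁻¹' {i} = C i ∪ (if i = 0 then (⋃ i, C i)ᶜ else ∅) := by
    intro i
    ext ω
    by_cases h : ∃ j, ω ∈ C j
    · obtain ⟨j, hj⟩ := h
      have h1 : ω ∈ C i ↔ j = i := ⟨huniq hj, fun h => h ▸ hj⟩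
      have h2 : ω ∉ (⋃ i, C i)ᶜ := fun h => h (Set.mem_iUnion.2 ⟨j, hj⟩)
      rw [Set.mem_preimage, Set.mem_singleton_iff, hL j ω hj, Set.mem_union, h1]
      split_ifs
      · simp only [h2, or_false]
      · simp only [Set.mem_empty_iff_false, or_false]
    · have h1 : ω ∉ C i := fun hi => h ⟨i, hi⟩
      have h2 : L ω = 0 := by simp only [L, dif_neg h]
      have h3 : ω ∈ (⋃ i, C i)ᶜ := fun hm => h (Set.mem_iUnion.1 hm)
      simp only [Set.mem_preimage, Set.mem_singleton_iff, h2, Set.mem_union, h1, false_or]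
      split_ifs with h0
      · exact iff_of_true h0.symm h3
      · simpa using fun h => h0 h.symm
  refine ⟨L, measurable_to_countable' fun i => ?_, fun i => ?_, ?_⟩
  · rw [hpre]
    refine (hC i).union ?_
    split_ifs
    exacts [hU.compl, MeasurableSet.empty]
  · rw [← hCr i]
    refine measureReal_congr ?_
    filter_upwards [hae] with ω hω
    obtain ⟨j, hj⟩ := Set.mem_iUnion.1 hω
    refine propext ⟨fun h => ?_, fun h => hL i ω h⟩
    have : L ω = i := h
    rw [← this, hL j ω hj]; exact hj
  · filter_upwards [hae] with ω hω
    obtain ⟨j, hj⟩ := Set.mem_iUnion.1 hω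
    rw [hL j ω hj]; exact hj

/-- A simple random variable whose nonzero values are taken with probabilities in `ℕ / N` is a
function of a uniformly distributed random variable with values in `Fin N`. -/
theorem NonAtomic.exists_uniform_factor (hP : NonAtomic P) (h : SimpleFunc Ω ℝ) (N : ℕ) [NeZero N]
    (hh : ∀ y, ∃ k : ℕ, P.real (h ⁻¹' {y}) = k * (N : ℝ)⁻¹) :
    ∃ (L : Ω → Fin N) (a : Fin N → ℝ), Measurable L ∧ (∀ i, P.real (L ⁻¹' {i}) = (N : ℝ)⁻¹) ∧
      ∀ᵐ ω ∂P, h ω = a (L ω) := by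
  classical
  have hN : (N : ℝ) ≠ 0 := NeZero.ne _
  choose k hk using hh
  choose C hC hCA hCd hCr using fun y => hP.exists_disjoint_measureReal_eq
    (r := (N : ℝ)⁻¹) (by positivity) (k y) (h.measurableSet_fiber y) (hk y)
  let ι := Σ y : h.range, Fin (k y)
  have hsum : ∑ y ∈ h.range, P.real (h ⁻¹' {y}) = 1 := by
    rw [sum_measureReal_preimage_singleton _ fun y _ => h.measurableSet_fiber y]
    simp
  -- Each fibre of `h` is cut into `k y` cells of probability `1 / N`; total mass one forces exactly
  -- `N` cells.
  have hcard : Fintype.card ι = N := by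
    simp only [ι, Fintype.card_sigma, Fintype.card_fin]
    rw [Finset.sum_coe_sort h.range k]
    simp only [hk, ← Finset.sum_mul] at hsum
    field_simp at hsum
    exact_mod_cast hsum
  let e : Fin N ≃ ι := (Fintype.equivFinOfCardEq hcard).symm
  have hd : Pairwise (Function.onFun Disjoint fun i : ι => C i.1 i.2) := by
    rintro ⟨y, i⟩ ⟨z, j⟩ hne
    by_cases hyz : y = z
    · subst hyz
      exact hCd y fun hij => hne (congrArg (Sigma.mk y) hij)
    · refine (Set.disjoint_left.2 fun ω hy hz => hyz ?_).mono (hCA y i) (hCA z j)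
      exact Subtype.ext ((show h ω = y from hy).symm.trans hz)
  obtain ⟨L, hL, hLr, hLm⟩ := exists_measurable_fin_of_disjoint (P := P)
    (C := fun i => C (e i).1 (e i).2) (fun i => hC _ _)
    (fun i j hij => hd (e.injective.ne hij)) (fun i => hCr _ _)
  refine ⟨L, fun i => (e i).1, hL, hLr, ?_⟩
  filter_upwards [hLm] with ω hω
  exact hCA _ _ hω

/-- Every simple random variable can be set to zero on a small event so that its values are taken
with probabilities in `ℕ / N`. -/
theorem NonAtomic.exists_restrict_rational (hP : NonAtomic P) (s : SimpleFunc Ω ℝ) {δ : ℝ}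
    (hδ : 0 < δ) :
    ∃ (N : ℕ) (B : Set Ω), 0 < N ∧ MeasurableSet B ∧ P.real Bᶜ < δ ∧
      ∀ y, ∃ k : ℕ, P.real (s.restrict B ⁻¹' {y}) = k * (N : ℝ)⁻¹ := by
  classical
  -- Rounding a fibre down to a multiple of `1 / N` loses at most `1 / N`, so the total loss is at
  -- most `card / N < δ`.
  obtain ⟨N, hN⟩ := exists_nat_gt (s.range.card / δ)
  have hN0 : (0 : ℝ) < N := lt_of_le_of_lt (by positivity) hN
  have hNn : 0 < N := by exact_mod_cast hN0
  let k : ℝ → ℕ := fun y => ⌊N * P.real (s ⁻¹' {y})⌋₊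
  have hk : ∀ y, k y * (N : ℝ)⁻¹ ≤ P.real (s ⁻¹' {y}) := fun y => by
    rw [← div_eq_mul_inv, div_le_iff₀ hN0, mul_comm]
    exact Nat.floor_le (by positivity)
  have hk' : ∀ y, P.real (s ⁻¹' {y}) - (N : ℝ)⁻¹ ≤ k y * (N : ℝ)⁻¹ := fun y => by
    have := Nat.lt_floor_add_one (N * P.real (s ⁻¹' {y}))
    rw [sub_le_iff_le_add, ← add_one_mul, ← div_eq_mul_inv, le_div_iff₀ hN0, mul_comm]
    exact this.le
  choose D hDs hD hDr using fun y => hP.exists_measureReal_eq (s.measurableSet_fiber y)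
    (by positivity) (hk y)
  set B : Set Ω := ⋃ y ∈ s.range, D y
  have hB : MeasurableSet B := Finset.measurableSet_biUnion _ fun y _ => hD y
  have hdisj : ∀ t : Finset ℝ, (t : Set ℝ).PairwiseDisjoint D := fun t y _ z _ hyz =>
    (Set.disjoint_left.2 fun ω hy hz => hyz ((show s ω = y from hy).symm.trans hz)).mono
      (hDs y) (hDs z)
  have hBm : P.real B = ∑ y ∈ s.range, k y * (N : ℝ)⁻¹ := by
    rw [measureReal_biUnion_finset (hdisj _) fun y _ => hD y]
    exact Finset.sum_congr rfl fun y _ => hDr y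
  have hmem : ∀ ω y, ω ∈ D y → y ∈ s.range := fun ω y hω => by
    rw [← show s ω = y from hDs y hω]; exact s.mem_range_self ω
  have hfib : ∀ y ≠ 0, s.restrict B ⁻¹' {y} = D y := by
    intro y hy
    ext ω
    simp only [Set.mem_preimage, SimpleFunc.restrict_apply _ hB, Set.mem_singleton_iff]
    constructor
    · intro h
      have hω : ω ∈ B := by
        by_contra hω; rw [Set.indicator_of_notMem hω] at h; exact hy h.symm
      rw [Set.indicator_of_mem hω] at h
      obtain ⟨z, -, hz⟩ := Set.mem_iUnion₂.1 hω
      have : s ω = z := hDs z hz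
      rw [← h, this]; exact hz
    · intro h
      rw [Set.indicator_of_mem (Set.mem_iUnion₂.2 ⟨y, hmem ω y h, h⟩)]
      exact hDs y h
  have hfib0 : s.restrict B ⁻¹' {0} = (⋃ y ∈ s.range.erase 0, D y)ᶜ := by
    ext ω
    have : ω ∈ s.restrict B ⁻¹' {0} ↔ ∀ y ≠ 0, ω ∉ s.restrict B ⁻¹' {y} := by
      simp only [Set.mem_preimage, Set.mem_singleton_iff]
      exact ⟨fun h y hy hy' => hy (hy'.symm.trans h), fun h => by_contra fun h0 => h _ h0 rfl⟩
    rw [this]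
    simp only [Set.mem_compl_iff, Set.mem_iUnion, not_exists, Finset.mem_erase, and_imp]
    exact ⟨fun h y hy _ hω => h y hy (by rwa [hfib y hy]),
      fun h y hy hω => by rw [hfib y hy] at hω; exact h y hy (hmem ω y hω) hω⟩
  refine ⟨N, B, hNn, hB, ?_, fun y => ?_⟩
  · have h1 : ∑ y ∈ s.range, P.real (s ⁻¹' {y}) = 1 := by
      rw [sum_measureReal_preimage_singleton _ fun y _ => s.measurableSet_fiber y]
      simp
    have h2 := Finset.sum_le_sum fun y (_ : y ∈ s.range) => hk' y
    rw [Finset.sum_sub_distrib, h1, ← hBm, Finset.sum_const, nsmul_eq_mul,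
      ← div_eq_mul_inv] at h2
    rw [probReal_compl_eq_one_sub hB]
    have : (s.range.card : ℝ) / N < δ := by
      rw [div_lt_iff₀ hN0]; rw [div_lt_iff₀ hδ] at hN; linarith
    linarith
  · by_cases hy : y = 0
    · subst hy
      have hle : ∑ y ∈ s.range.erase 0, k y ≤ N := by
        have : P.real (⋃ y ∈ s.range.erase 0, D y) ≤ 1 := measureReal_le_one
        rw [measureReal_biUnion_finset (hdisj _) fun y _ => hD y,
          Finset.sum_congr rfl fun y _ => hDr y, ← Finset.sum_mul, ← div_eq_mul_inv,
          div_le_one hN0] at this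
        exact_mod_cast this
      -- The fibre over `0` also absorbs `Bᶜ`, so its mass is what the nonzero fibres leave.
      refine ⟨N - ∑ y ∈ s.range.erase 0, k y, ?_⟩
      rw [hfib0, probReal_compl_eq_one_sub (Finset.measurableSet_biUnion _ fun y _ => hD y),
        measureReal_biUnion_finset (hdisj _) fun y _ => hD y,
        Finset.sum_congr rfl fun y _ => hDr y, ← Finset.sum_mul, Nat.cast_sub hle]
      push_cast
      rw [sub_mul, mul_inv_cancel₀ hN0.ne']
    · exact ⟨k y, by rw [hfib y hy, hDr]⟩

/-! ### Identically distributed copies -/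

theorem identDistrib_indicator_one {A B : Set Ω} (hA : MeasurableSet A) (hB : MeasurableSet B)
    (h : P.real A = P.real B) :
    IdentDistrib (A.indicator fun _ => (1 : ℝ)) (B.indicator fun _ => (1 : ℝ)) P P := by
  classical
  have hmA : Measurable (A.indicator fun _ => (1 : ℝ)) := measurable_const.indicator hA
  have hmB : Measurable (B.indicator fun _ => (1 : ℝ)) := measurable_const.indicator hB
  refine ⟨hmA.aemeasurable, hmB.aemeasurable, ?_⟩
  ext s hs
  have hAB : P A = P B := (measureReal_eq_measureReal_iff).1 h
  have hAB' : P Aᶜ = P Bᶜ := by rw [prob_compl_eq_one_sub hA, prob_compl_eq_one_sub hB, hAB]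
  rw [Measure.map_apply hmA hs, Measure.map_apply hmB hs, Set.indicator_const_preimage_eq_union,
    Set.indicator_const_preimage_eq_union]
  split_ifs <;> simp [hAB, hAB']

/-- The law of a uniform random variable is invariant under permutations of the values. -/
theorem identDistrib_comp_equiv {ι : Type*} [Countable ι] [MeasurableSpace ι]
    [DiscreteMeasurableSpace ι] {L : Ω → ι} (hL : Measurable L) {r : ℝ}
    (hr : ∀ i, P.real (L ⁻¹' {i}) = r) (e : ι ≃ ι) : IdentDistrib (e ∘ L) L P P := by
  have he : Measurable (e ∘ L) := (Measurable.of_discrete).comp hL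
  refine ⟨he.aemeasurable, hL.aemeasurable, ?_⟩
  refine Measure.ext_of_singleton fun i => ?_
  rw [Measure.map_apply he (measurableSet_singleton i),
    Measure.map_apply hL (measurableSet_singleton i), Set.preimage_comp]
  have : e ⁻¹' {i} = {e.symm i} := by ext j; simp [Equiv.eq_symm_apply]
  rw [this]
  exact (measureReal_eq_measureReal_iff).1 ((hr _).trans (hr _).symm)

end NonAtomic

/-! ### Elements of the space and their representatives -/

namespace RISpace

variable {Ω : Type*} [MeasurableSpace Ω] {P : Measure Ω} {X : RISpace P}

theorem Elem.ext {f g : X} (h : f.rv =ᵐ[P] g.rv) : f = g := Subtype.ext (AEEqFun.ext h)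

theorem rv_add (f g : X) : (f + g).rv =ᵐ[P] f.rv + g.rv := AEEqFun.coeFn_add f.rv g.rv

theorem rv_sub (f g : X) : (f - g).rv =ᵐ[P] f.rv - g.rv := AEEqFun.coeFn_sub f.rv g.rv

theorem rv_smul (c : ℝ) (f : X) : (c • f).rv =ᵐ[P] c • ⇑f.rv := AEEqFun.coeFn_smul c f.rv

theorem rv_zero : (0 : X).rv =ᵐ[P] 0 := AEEqFun.coeFn_zero

theorem rv_sum {ι : Type*} (s : Finset ι) (f : ι → X) :
    (∑ i ∈ s, f i).rv =ᵐ[P] fun ω => ∑ i ∈ s, (f i).rv ω := by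
  classical
  induction s using Finset.induction_on with
  | empty => simp only [Finset.sum_empty]; exact rv_zero
  | insert i s hi ih =>
    rw [Finset.sum_insert hi]
    filter_upwards [rv_add (f i) (∑ i ∈ s, f i), ih] with ω h1 h2
    rw [h1, Pi.add_apply, h2, Finset.sum_insert hi]

theorem norm_le_norm_of_ae_le {f g : X} (h : ∀ᵐ ω ∂P, |g.rv ω| ≤ |f.rv ω|) : ‖g‖ ≤ ‖f‖ :=
  (X.solid f g.rv h).2

theorem SameLaw.norm_eq {f g : X} (h : SameLaw g f) : ‖g‖ = ‖f‖ := (X.lawInvariant f g.rv h).2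

theorem exists_rv_ae_eq_of_ae_le (f : X) {g : Ω → ℝ} (hg : AEStronglyMeasurable g P)
    (h : ∀ᵐ ω ∂P, |g ω| ≤ |f.rv ω|) : ∃ k : X, k.rv =ᵐ[P] g := by
  obtain ⟨hm, -⟩ := X.solid f (AEEqFun.mk g hg) (by
    filter_upwards [h, AEEqFun.coeFn_mk g hg] with ω h1 h2
    rwa [h2])
  exact ⟨⟨_, hm⟩, AEEqFun.coeFn_mk g hg⟩

theorem exists_rv_ae_eq_of_identDistrib (f : X) {g : Ω → ℝ} (h : IdentDistrib g f.rv P P) :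
    ∃ k : X, k.rv =ᵐ[P] g := by
  have hg : AEStronglyMeasurable g P := h.aemeasurable_fst.aestronglyMeasurable
  obtain ⟨hm, -⟩ := X.lawInvariant f (AEEqFun.mk g hg)
    ((IdentDistrib.of_ae_eq (AEEqFun.mk g hg).aemeasurable (AEEqFun.coeFn_mk g hg)).trans h)
  exact ⟨⟨_, hm⟩, AEEqFun.coeFn_mk g hg⟩

theorem sameLaw_of_ae_eq {f g : X} {u v : Ω → ℝ} (hf : f.rv =ᵐ[P] u) (hg : g.rv =ᵐ[P] v)
    (h : IdentDistrib u v P P) : SameLaw f g :=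
  ((IdentDistrib.of_ae_eq f.rv.aemeasurable hf).trans h).trans
    (IdentDistrib.of_ae_eq g.rv.aemeasurable hg).symm

theorem rv_of_eq_one {one : X} (h1 : one.rv = 1) : ∀ᵐ ω ∂P, one.rv ω = 1 := by
  rw [h1]
  exact AEEqFun.coeFn_one

theorem norm_le_of_ae_abs_le_mul {f g : X} {C : ℝ} (hC : 0 ≤ C)
    (h : ∀ᵐ ω ∂P, |f.rv ω| ≤ C * |g.rv ω|) : ‖f‖ ≤ C * ‖g‖ := by
  have : ‖f‖ ≤ ‖C • g‖ := norm_le_norm_of_ae_le (by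
    filter_upwards [h, rv_smul C g] with ω h1 h2
    rwa [h2, Pi.smul_apply, smul_eq_mul, abs_mul, abs_of_nonneg hC])
  rwa [norm_smul, Real.norm_of_nonneg hC] at this

theorem exists_rv_ae_eq_of_bounded {one : X} (h1 : one.rv = 1) {g : Ω → ℝ}
    (hg : AEStronglyMeasurable g P) {C : ℝ} (h : ∀ᵐ ω ∂P, |g ω| ≤ C) :
    ∃ k : X, k.rv =ᵐ[P] g := by
  refine exists_rv_ae_eq_of_ae_le (C • one) hg ?_
  filter_upwards [h, rv_smul C one, rv_of_eq_one h1] with ω h2 h3 h4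
  rw [h3, Pi.smul_apply, h4, smul_eq_mul, mul_one]
  exact h2.trans (le_abs_self C)

theorem mem_of_approx {K : Submodule ℝ X} (hK : IsClosed (K : Set X)) {f : X}
    (h : ∀ ε > 0, ∃ k ∈ K, ‖f - k‖ < ε) : f ∈ K := by
  rw [← SetLike.mem_coe, ← hK.closure_eq, Metric.mem_closure_iff]
  intro ε hε
  obtain ⟨k, hk, hfk⟩ := h ε hε
  exact ⟨k, hk, by rwa [dist_eq_norm]⟩

/-! ### Law hulls and the use of AOCEA -/

theorem sub_mem_lawSpan_of_mem_lawHull {f g : X} (hg : g ∈ lawHull f) : f - g ∈ X.lawSpan := by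
  have hconv : Convex ℝ {g : X | f - g ∈ X.lawSpan} := by
    intro x hx y hy a b _ _ hab
    have : f - (a • x + b • y) = a • (f - x) + b • (f - y) := by
      rw [smul_sub, smul_sub, sub_add_sub_comm, ← add_smul, hab, one_smul]
    change f - (a • x + b • y) ∈ X.lawSpan
    rw [this]
    exact Submodule.add_mem _ (Submodule.smul_mem _ _ hx) (Submodule.smul_mem _ _ hy)
  exact convexHull_min (t := {g : X | f - g ∈ X.lawSpan})
    (fun g hg => Submodule.subset_span ⟨f, g, IdentDistrib.symm hg, rfl⟩) hconv hg

/-- For `f ≥ 0`, take `g` in the law hull and `v` order continuous with `g` near `v`. Then `(f - g)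
+ v` lies in `K` and differs from `f` by `g - v`. -/
theorem mem_of_aocea (hA : X.AOCEA) {K : Submodule ℝ X} (hK : IsClosed (K : Set X))
    (hS : X.lawSpan ≤ K) (hV : X.orderContPart ⊆ K) (f : X) : f ∈ K := by
  have hpos : ∀ f : X, (∀ᵐ ω ∂P, 0 ≤ f.rv ω) → f ∈ K := fun f hf =>
    mem_of_approx hK fun ε hε => by
      obtain ⟨g, hg, v, hv, hgv⟩ := hA f hf ε hε
      refine ⟨(f - g) + v, K.add_mem (hS (sub_mem_lawSpan_of_mem_lawHull hg)) (hV hv), ?_⟩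
      rwa [show f - (f - g + v) = g - v by abel]
  obtain ⟨k, hk⟩ := exists_rv_ae_eq_of_ae_le f (g := fun ω => max (f.rv ω) 0)
    (f.rv.measurable.max measurable_const).aestronglyMeasurable (Eventually.of_forall fun ω => by
      rw [abs_of_nonneg (le_max_right _ _)]
      exact max_le (le_abs_self _) (abs_nonneg _))
  -- Here `k` is the positive part of `f` and `k - f` the negative part.
  rw [← sub_sub_cancel k f]
  refine K.sub_mem (hpos _ ?_) (hpos _ ?_)
  · filter_upwards [hk] with ω h2
    rw [h2]; exact le_max_right _ _
  · filter_upwards [hk, rv_sub k f] with ω h2 h3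
    rw [h3, Pi.sub_apply, h2]
    exact sub_nonneg.2 (le_max_left _ _)

/-! ### Constants, averaging and small events -/

section

variable [IsProbabilityMeasure P]

theorem exists_rv_eq_one (hP : NonAtomic P) (X : RISpace P) : ∃ one : X, one.rv = 1 := by
  classical
  obtain ⟨f, hf, hf0⟩ := (Submodule.ne_bot_iff _).1 X.ne_bot
  let f : X := ⟨f, hf⟩
  have hfm : Measurable f.rv := f.rv.measurable
  have hset : ∀ ε : ℝ, MeasurableSet {ω | ε ≤ |f.rv ω|} := fun ε =>
    measurableSet_le measurable_const hfm.abs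
  obtain ⟨n, hn⟩ : ∃ n : ℕ, 0 < P.real {ω | 1 / ((n : ℝ) + 1) ≤ |f.rv ω|} := by
    by_contra! hcon
    have : ∀ᵐ ω ∂P, ∀ n : ℕ, ¬ 1 / ((n : ℝ) + 1) ≤ |f.rv ω| := by
      refine ae_all_iff.2 fun n => ?_
      rw [ae_iff]
      simp only [not_not]
      exact (measureReal_eq_zero_iff (μ := P)).1 ((hcon n).antisymm measureReal_nonneg)
    refine hf0 (AEEqFun.ext ?_)
    filter_upwards [this, AEEqFun.coeFn_zero (α := Ω) (β := ℝ) (μ := P)] with ω h1 h2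
    rw [h2]
    by_contra hne
    obtain ⟨n, hn⟩ := exists_nat_one_div_lt (abs_pos.2 hne)
    exact h1 n hn.le
  set A := {ω | 1 / ((n : ℝ) + 1) ≤ |f.rv ω|}
  -- An event of probability exactly `1 / N` fits inside `A`, so its indicator is dominated by a
  -- multiple of `f`; `N` equidistributed copies of it add up to `1`.
  obtain ⟨N, hN⟩ := exists_nat_gt (1 / P.real A)
  have hN0 : (0 : ℝ) < N := lt_trans (by positivity) hN
  have : NeZero N := ⟨by rintro rfl; simp at hN0⟩
  obtain ⟨B, hBA, hB, hBr⟩ := hP.exists_measureReal_eq (hset _) (t := (N : ℝ)⁻¹) (by positivity) (by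
    rw [inv_le_comm₀ hN0 hn, ← one_div]; exact hN.le)
  obtain ⟨b, hb⟩ := exists_rv_ae_eq_of_ae_le (((n : ℝ) + 1) • f)
    (g := B.indicator fun _ => (1 : ℝ))
    ((measurable_const.indicator hB).aestronglyMeasurable) (by
      filter_upwards [rv_smul ((n : ℝ) + 1) f] with ω hω
      rw [hω]
      by_cases hωB : ω ∈ B
      · have h1 : 1 / ((n : ℝ) + 1) ≤ |f.rv ω| := hBA hωB
        have h0 : (0 : ℝ) < n + 1 := by positivity
        rw [div_le_iff₀ h0] at h1
        simp only [Set.indicator_of_mem hωB, Pi.smul_apply, smul_eq_mul, abs_mul, abs_one,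
          abs_of_pos h0]
        linarith
      · simp only [Set.indicator_of_notMem hωB, abs_zero, abs_nonneg])
  obtain ⟨C, hC, -, hCd, hCr⟩ := hP.exists_disjoint_measureReal_eq (r := (N : ℝ)⁻¹)
    (by positivity) N MeasurableSet.univ (by simp [hN0.ne'])
  obtain ⟨L, hL, hLr, -⟩ := exists_measurable_fin_of_disjoint hC hCd hCr
  have hex : ∀ i, ∃ c : X, c.rv =ᵐ[P] (L ⁻¹' {i}).indicator fun _ => (1 : ℝ) := fun i =>
    exists_rv_ae_eq_of_identDistrib b
      ((identDistrib_indicator_one (hL (measurableSet_singleton i)) hB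
        ((hLr i).trans hBr.symm)).trans (IdentDistrib.of_ae_eq b.rv.aemeasurable hb).symm)
  choose c hc using hex
  refine ⟨∑ i, c i, AEEqFun.ext ?_⟩
  filter_upwards [rv_sum Finset.univ c, ae_all_iff.2 hc,
    AEEqFun.coeFn_one (α := Ω) (β := ℝ) (μ := P)] with ω h1 h2 h3
  rw [h1, h3, Finset.sum_eq_single (L ω)]
  · rw [h2]; simp
  · intro i _ hi; rw [h2]; simp [hi.symm]
  · simp

theorem norm_pos_of_rv_eq_one {one : X} (h1 : one.rv = 1) : 0 < ‖one‖ := by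
  refine norm_pos_iff.2 ?_
  rintro rfl
  have h := rv_zero (X := X)
  rw [h1] at h
  obtain ⟨ω, h2, h3⟩ := (h.and (AEEqFun.coeFn_one (α := Ω) (β := ℝ) (μ := P))).exists
  rw [h3] at h2
  exact one_ne_zero h2

/-- Averaging over the cyclic permutations of the values of a uniform random variable. -/
theorem uniform_factor_average {one : X} (h1 : one.rv = 1) {N : ℕ} [NeZero N] {L : Ω → Fin N}
    (hL : Measurable L) (hLr : ∀ i, P.real (L ⁻¹' {i}) = (N : ℝ)⁻¹) {a : Fin N → ℝ} {f : X}
    (hf : ∀ᵐ ω ∂P, f.rv ω = a (L ω)) :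
    f - (∫ ω, f.rv ω ∂P) • one ∈ X.lawSpan ∧ |∫ ω, f.rv ω ∂P| * ‖one‖ ≤ ‖f‖ := by
  have hN : (0 : ℝ) < N := by exact_mod_cast Nat.pos_of_ne_zero (NeZero.ne N)
  have hid : ∀ s : Fin N, IdentDistrib (fun ω => a (L ω + s)) (fun ω => a (L ω)) P P := fun s =>
    (identDistrib_comp_equiv hL hLr (Equiv.addRight s)).comp (Measurable.of_discrete (f := a))
  have hfd : IdentDistrib (fun ω => a (L ω)) f.rv P P :=
    (IdentDistrib.of_ae_eq f.rv.aemeasurable hf).symm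
  choose g hg using fun s => exists_rv_ae_eq_of_identDistrib f ((hid s).trans hfd)
  have hlaw : ∀ s, SameLaw (g s) f := fun s => sameLaw_of_ae_eq (hg s) hf (hid s)
  have hint : ∀ s, Integrable (fun ω => a (L ω + s)) P := fun s => by
    refine Integrable.of_bound (C := ∑ i, ‖a i‖)
      ((hid s).aemeasurable_fst.aestronglyMeasurable) (Eventually.of_forall fun ω => ?_)
    exact Finset.single_le_sum (f := fun i => ‖a i‖) (fun i _ => norm_nonneg _)
      (Finset.mem_univ _)
  have hshift : ∀ ω, ∑ s, a (L ω + s) = ∑ i, a i := fun ω =>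
    Equiv.sum_comp (Equiv.addLeft (L ω)) a
  have hmean : N * ∫ ω, f.rv ω ∂P = ∑ i, a i := by
    have h2 : ∑ s : Fin N, ∫ ω, a (L ω + s) ∂P = ∑ s : Fin N, ∫ ω, f.rv ω ∂P :=
      Finset.sum_congr rfl fun s _ => ((hid s).trans hfd).integral_eq
    rw [← integral_finsetSum _ fun s _ => hint s] at h2
    simp only [hshift, integral_const, probReal_univ, one_smul, Finset.sum_const,
      Finset.card_univ, Fintype.card_fin, nsmul_eq_mul] at h2
    exact h2.symm
  have hsum : ∑ s, g s = (N * ∫ ω, f.rv ω ∂P) • one := by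
    refine Elem.ext ?_
    filter_upwards [rv_sum Finset.univ g, ae_all_iff.2 hg,
      rv_smul (N * ∫ ω, f.rv ω ∂P) one, rv_of_eq_one h1] with ω h2 h3 h4 h5
    rw [h2, h4, Pi.smul_apply, h5, hmean, smul_eq_mul, mul_one, ← hshift ω]
    exact Finset.sum_congr rfl fun s _ => h3 s
  constructor
  · have : f - (∫ ω, f.rv ω ∂P) • one = (N : ℝ)⁻¹ • ∑ s, (f - g s) := by
      rw [Finset.sum_sub_distrib, hsum, Finset.sum_const, Finset.card_univ, Fintype.card_fin,
        smul_sub, smul_smul, ← mul_assoc, inv_mul_cancel₀ hN.ne', one_mul,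
        ← Nat.cast_smul_eq_nsmul ℝ, smul_smul, inv_mul_cancel₀ hN.ne', one_smul]
    rw [this]
    refine Submodule.smul_mem _ _ (Submodule.sum_mem _ fun s _ => Submodule.subset_span ?_)
    exact ⟨f, g s, (hlaw s).symm, rfl⟩
  · have h2 : ‖∑ s, g s‖ ≤ N * ‖f‖ := by
      refine (norm_sum_le _ _).trans ?_
      simp [(hlaw _).norm_eq]
    rw [hsum, norm_smul, norm_mul, Real.norm_of_nonneg hN.le, mul_assoc] at h2
    exact le_of_mul_le_mul_left h2 hN

/-- If `X` is not `L^∞`, the norms of indicators of small events are small. -/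
theorem norm_indicator_small (hP : NonAtomic P)
    (hX : (X.carrier : Set (Ω →ₘ[P] ℝ)) ≠ (Lp ℝ ⊤ P : Set (Ω →ₘ[P] ℝ)))
    {one : X} (h1 : one.rv = 1) {ε : ℝ} (hε : 0 < ε) :
    ∃ δ > 0, ∀ A : Set Ω, MeasurableSet A → P.real A < δ →
      ∀ f : X, (f.rv =ᵐ[P] A.indicator fun _ => 1) → ‖f‖ < ε := by
  classical
  by_contra! hcon
  have hexi : ∀ B : Set Ω, MeasurableSet B → ∃ b : X, b.rv =ᵐ[P] B.indicator fun _ => 1 :=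
    fun B hB => exists_rv_ae_eq_of_bounded h1 (C := 1)
      ((measurable_const.indicator hB).aestronglyMeasurable) (Eventually.of_forall fun ω => by
        by_cases h : ω ∈ B <;> simp [h])
  -- An event smaller than `B` whose indicator has norm at least `ε` has an equiprobable copy inside
  -- `B`; law invariance and solidity pass the bound to `B`.
  have hbig : ∀ B : Set Ω, MeasurableSet B → 0 < P.real B →
      ∀ b : X, (b.rv =ᵐ[P] B.indicator fun _ => 1) → ε ≤ ‖b‖ := by
    intro B hB hB0 b hb
    obtain ⟨A, hA, hAB, f, hf, hfε⟩ := hcon _ hB0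
    obtain ⟨D, hDB, hD, hDr⟩ := hP.exists_measureReal_eq hB measureReal_nonneg hAB.le
    obtain ⟨d, hd⟩ := hexi D hD
    have hfd : SameLaw f d := sameLaw_of_ae_eq hf hd (identDistrib_indicator_one hA hD hDr.symm)
    rw [hfd.norm_eq] at hfε
    refine hfε.trans (norm_le_norm_of_ae_le ?_)
    filter_upwards [hb, hd] with ω h2 h3
    rw [h2, h3]
    by_cases h : ω ∈ D
    · simp [h, hDB h]
    · simp [h]
  refine hX (Set.Subset.antisymm (fun f hf => ?_) (fun f hf => ?_))
  · let f : X := ⟨f, hf⟩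
    -- With this `C`, the indicator of `|f| > C` has norm at most `‖f‖ / C < ε`, so that event must
    -- be null.
    refine Lp.mem_Lp_of_ae_bound (‖f‖ / ε + 1) ?_
    change ∀ᵐ ω ∂P, |f.rv ω| ≤ ‖f‖ / ε + 1
    have hC : 0 < ‖f‖ / ε + 1 := by positivity
    set C := ‖f‖ / ε + 1 with hCdef
    have hBm : MeasurableSet {ω | ¬ |f.rv ω| ≤ C} :=
      (measurableSet_le f.rv.measurable.abs measurable_const).compl
    rw [ae_iff]
    by_contra hne
    obtain ⟨b, hb⟩ := hexi _ hBm
    have h2 := hbig _ hBm (ENNReal.toReal_pos hne (measure_ne_top _ _)) b hb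
    have h3 : ‖b‖ ≤ C⁻¹ * ‖f‖ := by
      refine norm_le_of_ae_abs_le_mul (by positivity) ?_
      filter_upwards [hb] with ω hω
      rw [hω]
      by_cases h : |f.rv ω| ≤ C
      · simp only [Set.mem_ofPred_eq, h, not_true_eq_false, not_false_eq_true,
          Set.indicator_of_notMem, abs_zero]
        positivity
      · rw [Set.indicator_of_mem (show ω ∈ {ω | ¬ |f.rv ω| ≤ C} from h), abs_one,
          inv_mul_eq_div, le_div_iff₀ hC, one_mul]
        exact (not_le.1 h).le
    have h4 : ε * C ≤ ‖f‖ := by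
      have := h2.trans h3
      rwa [inv_mul_eq_div, le_div_iff₀ hC] at this
    rw [hCdef, mul_add, mul_div_cancel₀ _ hε.ne'] at h4
    linarith
  · have hfin : eLpNormEssSup f P < ⊤ := by
      have := (Lp.memLp (⟨f, hf⟩ : Lp ℝ ⊤ P)).2
      rwa [eLpNorm_exponent_top] at this
    obtain ⟨k, hk⟩ := exists_rv_ae_eq_of_bounded h1 f.aestronglyMeasurable
      (C := (eLpNormEssSup f P).toReal) (by
        filter_upwards [ae_le_eLpNormEssSup (f := f) (μ := P)] with ω hω
        have := ENNReal.toReal_mono hfin.ne hω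
        rwa [toReal_enorm] at this)
    rw [← AEEqFun.ext hk]
    exact k.2

/-! ### Integrability and continuity of the expectation -/

theorem exists_restrict_average (hP : NonAtomic P) {one : X} (h1 : one.rv = 1)
    (s : SimpleFunc Ω ℝ) {δ : ℝ} (hδ : 0 < δ) :
    ∃ (k : X) (B : Set Ω), MeasurableSet B ∧ P.real Bᶜ < δ ∧ (k.rv =ᵐ[P] B.indicator s) ∧
      k - (∫ ω, k.rv ω ∂P) • one ∈ X.lawSpan ∧ |∫ ω, k.rv ω ∂P| * ‖one‖ ≤ ‖k‖ := by
  obtain ⟨N, B, hN, hB, hBδ, hfib⟩ := hP.exists_restrict_rational s hδ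
  have : NeZero N := ⟨hN.ne'⟩
  obtain ⟨L, a, hL, hLr, hLa⟩ := hP.exists_uniform_factor (s.restrict B) N hfib
  obtain ⟨M, hM⟩ := (s.restrict B).exists_forall_norm_le
  obtain ⟨k, hk⟩ := exists_rv_ae_eq_of_bounded h1
    (s.restrict B).measurable.aestronglyMeasurable (Eventually.of_forall hM)
  refine ⟨k, B, hB, hBδ, by rwa [SimpleFunc.coe_restrict _ hB] at hk, ?_⟩
  refine uniform_factor_average h1 hL hLr (a := a) ?_
  filter_upwards [hk, hLa] with ω h2 h3
  rw [h2, h3]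

theorem integral_simpleFunc_mul_norm_le (hP : NonAtomic P) {one : X} (h1 : one.rv = 1)
    (s : SimpleFunc Ω ℝ) {f : X} (hsf : ∀ᵐ ω ∂P, |s ω| ≤ |f.rv ω|) :
    (∫ ω, s ω ∂P) * ‖one‖ ≤ ‖f‖ := by
  have hone := norm_pos_of_rv_eq_one h1
  obtain ⟨M, hM⟩ := s.exists_forall_norm_le
  have hsi : Integrable s P := SimpleFunc.integrable_of_isFiniteMeasure s
  refine le_of_forall_pos_le_add fun ε hε => ?_
  have hM0 : 0 < |M| + 1 := by positivity
  obtain ⟨k, B, hB, hBδ, hk, -, hkn⟩ :=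
    -- The discarded event contributes at most `(|M| + 1) * δ * ‖one‖ = ε`; the `+ 1` keeps the
    -- denominator positive.
    exists_restrict_average hP h1 s (δ := ε / ((|M| + 1) * ‖one‖)) (by positivity)
  have hkf : ‖k‖ ≤ ‖f‖ := norm_le_norm_of_ae_le (by
    filter_upwards [hk, hsf] with ω h2 h3
    rw [h2]
    by_cases h : ω ∈ B <;> simp [h, h3])
  have hki : ∫ ω, k.rv ω ∂P = ∫ ω in B, s ω ∂P := by
    rw [integral_congr_ae hk, integral_indicator hB]
  have hsplit : ∫ ω in B, s ω ∂P + ∫ ω in Bᶜ, s ω ∂P = ∫ ω, s ω ∂P := integral_add_compl hB hsi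
  have hrest : ∫ ω in Bᶜ, s ω ∂P ≤ (|M| + 1) * P.real Bᶜ :=
    (le_abs_self _).trans (norm_setIntegral_le_of_norm_le_const (measure_lt_top _ _)
      fun ω _ => (hM ω).trans (by linarith [le_abs_self M]))
  rw [lt_div_iff₀ (by positivity)] at hBδ
  calc (∫ ω, s ω ∂P) * ‖one‖
      = (∫ ω in B, s ω ∂P) * ‖one‖ + (∫ ω in Bᶜ, s ω ∂P) * ‖one‖ := by rw [← hsplit, add_mul]
    _ ≤ |∫ ω, k.rv ω ∂P| * ‖one‖ + ((|M| + 1) * P.real Bᶜ) * ‖one‖ := by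
        rw [← hki]; gcongr; exact le_abs_self _
    _ ≤ ‖f‖ + ε := by
        refine add_le_add (hkn.trans hkf) (le_trans (le_of_eq ?_) hBδ.le)
        ring

/-- The integral is a supremum over simple functions below `|f|`, each controlled by the averaging
inequality; integrability need not be known beforehand. -/
theorem lintegral_enorm_rv_le (hP : NonAtomic P) {one : X} (h1 : one.rv = 1) (f : X) :
    ∫⁻ ω, ‖f.rv ω‖ₑ ∂P ≤ ENNReal.ofReal (‖f‖ / ‖one‖) := by
  have hone := norm_pos_of_rv_eq_one h1
  rw [lintegral_eq_nnreal]
  refine iSup₂_le fun φ hφ => ?_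
  let s : SimpleFunc Ω ℝ := φ.map NNReal.toReal
  have hs : ∀ ω, |s ω| ≤ |f.rv ω| := fun ω => by
    have := hφ ω
    rw [enorm_eq_nnnorm, ENNReal.coe_le_coe] at this
    simpa [s] using NNReal.coe_le_coe.2 this
  have h2 := integral_simpleFunc_mul_norm_le hP h1 s (Eventually.of_forall hs)
  rw [← le_div_iff₀ hone] at h2
  rw [← SimpleFunc.lintegral_eq_lintegral]
  refine le_trans (le_of_eq ?_) (ENNReal.ofReal_le_ofReal h2)
  rw [ofReal_integral_eq_lintegral_ofReal (SimpleFunc.integrable_of_isFiniteMeasure s)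
    (Eventually.of_forall fun ω => by simp [s])]
  simp [s]

theorem integrable_rv (hP : NonAtomic P) {one : X} (h1 : one.rv = 1) (f : X) :
    Integrable f.rv P :=
  ⟨f.rv.aestronglyMeasurable,
    (lintegral_enorm_rv_le hP h1 f).trans_lt ENNReal.ofReal_lt_top⟩

theorem exists_integral_clm (hP : NonAtomic P) {one : X} (h1 : one.rv = 1) :
    ∃ E : X →L[ℝ] ℝ, ∀ f, E f = ∫ ω, f.rv ω ∂P := by
  have hone := norm_pos_of_rv_eq_one h1
  refine ⟨LinearMap.mkContinuous
    { toFun := fun f => ∫ ω, f.rv ω ∂P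
      map_add' := fun f g => ?_
      map_smul' := fun c f => ?_ } ‖one‖⁻¹ fun f => ?_, fun f => rfl⟩
  · rw [integral_congr_ae (rv_add f g)]
    exact integral_add (integrable_rv hP h1 f) (integrable_rv hP h1 g)
  · rw [integral_congr_ae (rv_smul c f)]
    exact integral_smul c _
  · refine (norm_integral_le_lintegral_norm _).trans ?_
    refine (ENNReal.toReal_le_of_le_ofReal (by positivity) ?_).trans
      (le_of_eq (div_eq_inv_mul ‖f‖ ‖one‖))
    simpa only [ofReal_norm] using lintegral_enorm_rv_le hP h1 f

/-! ### From simple variables to the order continuous part -/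

/-- A closed subspace containing suitable restrictions of a simple random variable to events of
probability close to one contains that random variable. -/
theorem mem_of_rv_simpleFunc (hP : NonAtomic P)
    (hX : (X.carrier : Set (Ω →ₘ[P] ℝ)) ≠ (Lp ℝ ⊤ P : Set (Ω →ₘ[P] ℝ)))
    {one : X} (h1 : one.rv = 1) {K : Submodule ℝ X} (hK : IsClosed (K : Set X))
    (s : SimpleFunc Ω ℝ)
    (hs : ∀ δ > 0, ∃ (k : X) (B : Set Ω), MeasurableSet B ∧ P.real Bᶜ < δ ∧
      (k.rv =ᵐ[P] B.indicator s) ∧ k ∈ K)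
    {f : X} (hf : f.rv =ᵐ[P] s) : f ∈ K := by
  obtain ⟨M, hM⟩ := s.exists_forall_norm_le
  have hM0 : 0 < |M| + 1 := by positivity
  refine mem_of_approx hK fun ε hε => ?_
  obtain ⟨δ, hδ, hsmall⟩ := norm_indicator_small hP hX h1 (ε := ε / (|M| + 1)) (by positivity)
  obtain ⟨k, B, hB, hBδ, hk, hkK⟩ := hs δ hδ
  obtain ⟨b, hb⟩ := exists_rv_ae_eq_of_bounded h1 (C := 1)
    ((measurable_const.indicator hB.compl).aestronglyMeasurable
      (f := Bᶜ.indicator fun _ => (1 : ℝ))) (Eventually.of_forall fun ω => by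
        by_cases h : ω ∈ B <;> simp [h])
  refine ⟨k, hkK, lt_of_le_of_lt (norm_le_of_ae_abs_le_mul (g := b) hM0.le ?_) ?_⟩
  · filter_upwards [rv_sub f k, hf, hk, hb] with ω h2 h3 h4 h5
    rw [h2, Pi.sub_apply, h3, h4, h5]
    have := hM ω
    rw [Real.norm_eq_abs] at this
    by_cases h : ω ∈ B
    · simp [h]
    · simp only [h, not_false_eq_true, Set.indicator_of_notMem, sub_zero, Set.mem_compl_iff,
        Set.indicator_of_mem, abs_one, mul_one]
      linarith [le_abs_self M]
  · have := hsmall Bᶜ hB.compl hBδ b hb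
    rwa [lt_div_iff₀ hM0, mul_comm] at this

theorem exists_simpleFunc_abs_sub_le {g : Ω → ℝ} (hg : Measurable g) {C η : ℝ} (hη : 0 < η) :
    ∃ s : SimpleFunc Ω ℝ, ∀ ω, |g ω| ≤ C → |g ω - s ω| ≤ η := by
  -- Clamping to `[-C, C]` leaves finitely many floors and changes nothing where `|g ω| ≤ C`.
  let c : Ω → ℝ := fun ω => max (-C) (min C (g ω))
  have hc : Measurable c := measurable_const.max (measurable_const.min hg)
  let z : Ω → ℤ := fun ω => ⌊c ω / η⌋
  have hz : Measurable z := (hc.div_const η).floor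
  have hfin : (Set.range z).Finite := by
    refine (Set.finite_Icc ⌊-C / η⌋ ⌊max (-C) C / η⌋).subset ?_
    rintro _ ⟨ω, rfl⟩
    exact ⟨Int.floor_mono (by gcongr; exact le_max_left _ _),
      Int.floor_mono (by gcongr; exact max_le_max le_rfl (min_le_left _ _))⟩
  let s : SimpleFunc Ω ℤ := ⟨z, fun n => hz (measurableSet_singleton n), hfin⟩
  refine ⟨s.map fun n : ℤ => (n : ℝ) * η, fun ω hω => ?_⟩
  have hcg : c ω = g ω := by
    rw [abs_le] at hω
    simp [c, hω.1, hω.2]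
  change |g ω - (⌊c ω / η⌋ : ℝ) * η| ≤ η
  rw [hcg]
  have h1 := Int.floor_le (g ω / η)
  have h2 := Int.lt_floor_add_one (g ω / η)
  rw [le_div_iff₀ hη] at h1
  rw [div_lt_iff₀ hη] at h2
  rw [abs_le]
  constructor <;> linarith

theorem mem_of_rv_bounded {one : X} (h1 : one.rv = 1) {K : Submodule ℝ X}
    (hK : IsClosed (K : Set X))
    (hs : ∀ (s : SimpleFunc Ω ℝ) (f : X), (f.rv =ᵐ[P] s) → f ∈ K)
    {f : X} {C : ℝ} (hf : ∀ᵐ ω ∂P, |f.rv ω| ≤ C) : f ∈ K := by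
  have hone := norm_pos_of_rv_eq_one h1
  refine mem_of_approx hK fun ε hε => ?_
  have hη : 0 < ε / (2 * ‖one‖) := by positivity
  obtain ⟨s, hsf⟩ := exists_simpleFunc_abs_sub_le f.rv.measurable (C := C) hη
  obtain ⟨M, hM⟩ := s.exists_forall_norm_le
  obtain ⟨k, hk⟩ := exists_rv_ae_eq_of_bounded h1 s.measurable.aestronglyMeasurable
    (Eventually.of_forall hM)
  refine ⟨k, hs s k hk, lt_of_le_of_lt
    (norm_le_of_ae_abs_le_mul (g := one) hη.le ?_) (?_ : _ < ε)⟩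
  · filter_upwards [rv_sub f k, hk, hf, rv_of_eq_one h1] with ω h2 h3 h4 h5
    rw [h2, Pi.sub_apply, h3, h5, abs_one, mul_one]
    exact hsf ω h4
  · have : ε / (2 * ‖one‖) * ‖one‖ = ε / 2 := by field_simp
    linarith

theorem mem_of_mem_orderContPart (hP : NonAtomic P) {one : X} (h1 : one.rv = 1)
    {K : Submodule ℝ X} (hK : IsClosed (K : Set X))
    (hb : ∀ (f : X) (C : ℝ), (∀ᵐ ω ∂P, |f.rv ω| ≤ C) → f ∈ K)
    {f : X} (hf : f ∈ X.orderContPart) : f ∈ K := by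
  refine mem_of_approx hK fun ε hε => ?_
  obtain ⟨δ, hδ, hsmall⟩ := hf ε hε
  have hI : 0 ≤ ∫ ω, |f.rv ω| ∂P := integral_nonneg fun ω => abs_nonneg _
  -- Chosen so that `C * δ` exceeds the integral; Markov then gives `|f| ≥ C` probability below `δ`.
  set C := (∫ ω, |f.rv ω| ∂P) / δ + 1 with hC
  have hC0 : 0 < C := by positivity
  have hA : MeasurableSet {ω | C ≤ |f.rv ω|} :=
    measurableSet_le measurable_const f.rv.measurable.abs
  have hmarkov : C * P.real {ω | C ≤ |f.rv ω|} ≤ ∫ ω, |f.rv ω| ∂P :=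
    mul_meas_ge_le_integral_of_nonneg (Eventually.of_forall fun ω => abs_nonneg _)
      (integrable_rv hP h1 f).abs C
  have hlt : P.real {ω | C ≤ |f.rv ω|} < δ := by
    by_contra! h
    have h2 : C * δ ≤ C * P.real {ω | C ≤ |f.rv ω|} := by gcongr
    have h3 : C * δ = (∫ ω, |f.rv ω| ∂P) + δ := by rw [hC]; field_simp
    linarith
  refine ⟨f - restrict f _ hA, hb _ C ?_, by simpa using hsmall _ hA hlt⟩
  filter_upwards [rv_sub f (restrict f _ hA), AEEqFun.coeFn_mk
    ({ω | C ≤ |f.rv ω|}.indicator f.rv) (f.rv.aestronglyMeasurable.indicator hA)] with ω h2 h3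
  rw [h2, Pi.sub_apply, show (restrict f _ hA).rv ω = _ from h3]
  by_cases h : C ≤ |f.rv ω|
  · rw [Set.indicator_of_mem (show ω ∈ {ω | C ≤ |f.rv ω|} from h), sub_self, abs_zero]
    exact hC0.le
  · rw [Set.indicator_of_notMem (show ω ∉ {ω | C ≤ |f.rv ω|} from h), sub_zero]
    exact (not_le.1 h).le

end

end RISpace

/-! ### The closure of the law span and law-invariant functionals -/

theorem proposition3p1 {Ω : Type*} [MeasurableSpace Ω] (P : Measure Ω) [IsProbabilityMeasure P]
    (hP : NonAtomic P) (X : RISpace P)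
    (hX : (X.carrier : Set (Ω →ₘ[P] ℝ)) ≠ (Lp ℝ ⊤ P : Set (Ω →ₘ[P] ℝ)))
    (hA : X.AOCEA) :
    (∀ f : X, Integrable f.rv P) ∧
    closure (X.lawSpan : Set X) = X.meanZero ∧
    ∃ one : X, one.rv = 1 ∧
      ∀ ρ : X →L[ℝ] ℝ, RISpace.IsLawInvariant ρ →
        ∀ f : X, ρ f = ρ one * ∫ ω, f.rv ω ∂P := by
  obtain ⟨one, h1⟩ := RISpace.exists_rv_eq_one hP X
  obtain ⟨E, hE⟩ := RISpace.exists_integral_clm hP h1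
  let T : X →L[ℝ] X := ContinuousLinearMap.id ℝ X - E.smulRight one
  have hT : ∀ f, T f = f - (∫ ω, f.rv ω ∂P) • one := fun f => by simp [T, hE]
  have hSE : X.lawSpan ≤ LinearMap.ker (E : X →ₗ[ℝ] ℝ) := by
    refine Submodule.span_le.2 ?_
    rintro _ ⟨f, g, hfg, rfl⟩
    have : ∫ ω, f.rv ω ∂P = ∫ ω, g.rv ω ∂P := hfg.integral_eq
    rw [SetLike.mem_coe, LinearMap.mem_ker, ContinuousLinearMap.coe_coe, map_sub, hE, hE, this,
      sub_self]
  -- Pulling the closure back along the continuous centering map `T` gives a closed subspace, so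
  -- density arguments apply to `K` itself.
  let K : Submodule ℝ X := X.lawSpan.topologicalClosure.comap (T : X →ₗ[ℝ] X)
  have hK : IsClosed (K : Set X) :=
    (Submodule.isClosed_topologicalClosure _).preimage T.continuous
  have hTK : ∀ f : X, f - (∫ ω, f.rv ω ∂P) • one ∈ X.lawSpan → f ∈ K := fun f hf => by
    refine Submodule.le_topologicalClosure _ ?_
    rwa [ContinuousLinearMap.coe_coe, hT]
  have hSK : X.lawSpan ≤ K := fun f hf => hTK f (by
    have : E f = 0 := hSE hf
    rwa [← hE, this, zero_smul, sub_zero])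
  have hsimple : ∀ (s : SimpleFunc Ω ℝ) (f : X), (f.rv =ᵐ[P] s) → f ∈ K := fun s f hf =>
    RISpace.mem_of_rv_simpleFunc hP hX h1 hK s (fun δ hδ => by
      obtain ⟨k, B, hB, hBδ, hk, hkS, -⟩ := RISpace.exists_restrict_average hP h1 s hδ
      exact ⟨k, B, hB, hBδ, hk, hTK k hkS⟩) hf
  have hV : X.orderContPart ⊆ K := fun f hf =>
    RISpace.mem_of_mem_orderContPart hP h1 hK
      (fun f C hf => RISpace.mem_of_rv_bounded h1 hK hsimple hf) hf
  have hall : ∀ f : X, f - (∫ ω, f.rv ω ∂P) • one ∈ closure (X.lawSpan : Set X) := fun f => by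
    have : T f ∈ X.lawSpan.topologicalClosure := RISpace.mem_of_aocea hA hK hSK hV f
    rwa [hT, ← SetLike.mem_coe, Submodule.topologicalClosure_coe] at this
  refine ⟨RISpace.integrable_rv hP h1, Set.Subset.antisymm ?_ ?_, one, h1, fun ρ hρ f => ?_⟩
  · refine closure_minimal (fun f hf => ?_) ?_
    · exact (hE f).symm.trans (hSE hf)
    · have : X.meanZero = E ⁻¹' {0} := by
        ext f
        rw [Set.mem_preimage, hE]
        rfl
      rw [this]
      exact isClosed_singleton.preimage E.continuous
  · intro f hf
    have h2 := hall f
    rwa [show ∫ ω, f.rv ω ∂P = 0 from hf, zero_smul, sub_zero] at h2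
  · have hker : closure (X.lawSpan : Set X) ⊆ ρ ⁻¹' {0} := by
      refine closure_minimal ?_ (isClosed_singleton.preimage ρ.continuous)
      have : X.lawSpan ≤ LinearMap.ker (ρ : X →ₗ[ℝ] ℝ) := by
        refine Submodule.span_le.2 ?_
        rintro _ ⟨f, g, hfg, rfl⟩
        simp [hρ f g hfg]
      exact fun f hf => this hf
    have h2 : ρ (f - (∫ ω, f.rv ω ∂P) • one) = 0 := hker (hall f)
    rw [map_sub, map_smul, sub_eq_zero, smul_eq_mul] at h2
    rw [h2, mul_comm]
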